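/- For a finite simple graph $G$ on at least two vertices let $\lambda_1(G)\ge\lambda_2(G)\ge\cdots$ be the eigenvalues of its adjacency matrix, listed with multiplicity; the spectral gap of $G$ is $\lambda_1(G)-\lambda_2(G)$. For every integer $n\ge 3$, let $m_n$ denote the minimum of the spectral gaps of all connected cubic (that is, $3$-regular) bipartite graphs on $2n$ vertices; this minimum exists. Then $$m_n=(1+o(1))\,\frac{\pi^2}{n^2}\qquad (n\to\infty),$$ that is, there is a sequence $\varepsilon_n\to 0$ with $m_n=(1+\varepsilon_n)\,\pi^2/n^2$ for every $n\ge 3$. -/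

import Mathlib

/-- The adjacency matrix of a graph, over the reals, is Hermitian (real symmetric). -/
theorem SimpleGraph.adjMatrix_real_isHermitian {V : Type*} (G : SimpleGraph V)
    [DecidableRel G.Adj] : (G.adjMatrix ℝ).IsHermitian := by
  rw [Matrix.IsHermitian, Matrix.conjTranspose_eq_transpose_of_trivial]
  exact G.transpose_adjMatrix

/-- The spectral gap of a finite graph: the difference `λ₁ - λ₂` of the two largest eigenvalues of
its adjacency matrix. Here `λ₁ ≥ λ₂ ≥ ⋯` are all the eigenvalues, repeated according to
multiplicity (`Matrix.IsHermitian.eigenvalues₀` lists them in non-increasing order).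
For graphs with fewer than two vertices the value is set to `0`. -/
noncomputable def SimpleGraph.spectralGap {V : Type*} [Fintype V] [DecidableEq V]
    (G : SimpleGraph V) [DecidableRel G.Adj] : ℝ :=
  if h : 1 < Fintype.card V then
    G.adjMatrix_real_isHermitian.eigenvalues₀ ⟨0, Nat.zero_lt_of_lt h⟩ -
      G.adjMatrix_real_isHermitian.eigenvalues₀ ⟨1, h⟩
  else 0

open scoped Classical in
/-- The set of spectral gaps of connected cubic bipartite graphs on `2 * n` (labelled) vertices. -/
noncomputable def cubicBipartiteSpectralGaps (n : ℕ) : Set ℝ :=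
  {g | ∃ G : SimpleGraph (Fin (2 * n)),
    G.Connected ∧ G.IsRegularOfDegree 3 ∧ G.IsBipartite ∧ G.spectralGap = g}

/-! For a connected regular graph the gap is the least ratio of energy to square norm over nonzero
functions of mean zero (`SimpleGraph.spectralGap_variational`). Both bounds compare this ratio with
that of the path on `n` vertices, whose minimum is `2 - 2 * cos (π / n)`.

Lower bound: order the vertices by the value of the function. Expanding each edge term into
increments between consecutive vertices gives a quadratic form in nonnegative increments, whose
coefficients count the edges crossing initial cuts. Colour signs and parity show that these cuts
have alternately at least 3 and 2 edges (`SimpleGraph.two_le_card_cutPairs`), and degree 3 forces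
consecutive cuts to share an edge (`SimpleGraph.one_le_card_crossing_succ`). Averaging over
consecutive pairs of vertices (`alternating_energy_ge`) then reduces the bound to `path_poincare`.

Upper bound: test a ladder, closed at both ends, with the cosine mode of the path. Rungs cost
nothing, the other ladder edges reproduce the path energy, and the end chords cost only `O(n⁻⁴)`,
because the cosine is flat there. -/

open Finset

/-! ### Sharp inequalities on the path -/

/-- Discrete Dirichlet inequality: a sequence vanishing at `0` and `n`. -/
theorem dirichlet_sum_sq_le {n : ℕ} (hn : 2 ≤ n) (S : ℕ → ℝ) (h0 : S 0 = 0) (h1 : S n = 0) :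
    (2 - 2 * Real.cos (Real.pi / n)) * ∑ i ∈ range n, S i ^ 2
      ≤ ∑ i ∈ range n, (S (i + 1) - S i) ^ 2 := by
  set θ := Real.pi / n with hθ
  have hn0 : (0 : ℝ) < n := by exact_mod_cast (by omega : 0 < n)
  have hθ0 : 0 < θ := div_pos Real.pi_pos hn0
  have hnθ : n * θ = Real.pi := by rw [hθ]; field_simp
  set s : ℕ → ℝ := fun i => Real.sin (i * θ) with hs
  have hpos : ∀ i, 0 < i → i < n → 0 < s i := by
    intro i hi hin
    have hi' : (0 : ℝ) < i := by exact_mod_cast hi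
    have hin' : (i : ℝ) < n := by exact_mod_cast hin
    apply Real.sin_pos_of_pos_of_lt_pi (by positivity)
    rw [← hnθ]
    exact mul_lt_mul_of_pos_right hin' hθ0
  have hrec : ∀ i, s (i + 2) + s i = 2 * Real.cos θ * s (i + 1) := by
    intro i
    simp only [hs]
    have e1 : ((i + 2 : ℕ) : ℝ) * θ = ((i + 1 : ℕ) : ℝ) * θ + θ := by push_cast; ring
    have e2 : (i : ℝ) * θ = ((i + 1 : ℕ) : ℝ) * θ - θ := by push_cast; ring
    rw [e1, e2, Real.sin_add, Real.sin_sub]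
    ring
  have hs0 : s 0 = 0 := by simp [hs]
  have hsn : s n = 0 := by simp [hs, hnθ]
  -- Comparison with the positive solution `s` of the recurrence: the induction step is AM-GM
  -- weighted by the ratio of consecutive sines.
  have key : ∀ m, m + 1 < n → (1 - s m / s (m + 1)) * S (m + 1) ^ 2
      ≤ ∑ i ∈ range (m + 1), (S (i + 1) - S i) ^ 2
        - (2 - 2 * Real.cos θ) * ∑ i ∈ range (m + 1), S i ^ 2 := by
    intro m
    induction m with
    | zero => intro _; simp [hs0, h0]
    | succ m ih =>
      intro hm
      have ih := ih (by omega)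
      rw [sum_range_succ _ (m + 1), sum_range_succ _ (m + 1)]
      have p1 := hpos (m + 1) (by omega) (by omega)
      have p2 := hpos (m + 2) (by omega) (by omega)
      have r : s m / s (m + 1) = 2 * Real.cos θ - s (m + 2) / s (m + 1) := by
        field_simp; linarith [hrec m]
      rw [r] at ih
      have q : 2 * S (m + 1) * S (m + 2) ≤ s (m + 2) / s (m + 1) * S (m + 1) ^ 2
          + s (m + 1) / s (m + 2) * S (m + 2) ^ 2 := by
        have : s (m + 2) / s (m + 1) * S (m + 1) ^ 2 + s (m + 1) / s (m + 2) * S (m + 2) ^ 2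
            - 2 * S (m + 1) * S (m + 2)
            = (s (m + 2) * S (m + 1) - s (m + 1) * S (m + 2)) ^ 2 / (s (m + 1) * s (m + 2)) := by
          field_simp
          ring
        have h2 : 0 ≤ (s (m + 2) * S (m + 1) - s (m + 1) * S (m + 2)) ^ 2
            / (s (m + 1) * s (m + 2)) := by positivity
        linarith
      nlinarith [ih, q]
  obtain ⟨m, rfl⟩ : ∃ m, n = m + 2 := ⟨n - 2, by omega⟩
  have k := key m (by omega)
  have p1 := hpos (m + 1) (by omega) (by omega)
  -- Here `s (m + 2) = 0`, so the boundary coefficient is exactly what the last step needs.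
  have r : s m / s (m + 1) = 2 * Real.cos θ := by
    field_simp; linarith [hrec m]
  rw [r] at k
  rw [sum_range_succ _ (m + 1), sum_range_succ _ (m + 1), h1]
  nlinarith [k]

theorem cos_pi_div_lt_one {n : ℕ} (hn : 2 ≤ n) : Real.cos (Real.pi / n) < 1 := by
  have hn0 : (1 : ℝ) ≤ n := by exact_mod_cast (by omega : 1 ≤ n)
  rw [← Real.cos_zero]
  apply Real.cos_lt_cos_of_nonneg_of_le_pi le_rfl
  · exact div_le_self Real.pi_pos.le hn0
  · have := Real.pi_pos
    positivity

/-- Poincaré inequality on the path with `n` vertices, with the sharp constant. -/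
theorem path_poincare {n : ℕ} (hn : 2 ≤ n) (g : ℕ → ℝ) (hg : ∑ i ∈ range n, g i = 0) :
    (2 - 2 * Real.cos (Real.pi / n)) * ∑ i ∈ range n, g i ^ 2
      ≤ ∑ i ∈ range (n - 1), (g (i + 1) - g i) ^ 2 := by
  -- Mean zero makes the partial sums vanish at both ends, so the Dirichlet inequality applies to
  -- them. Summation by parts and AM-GM with weight `c` transfer it to `g` with the same constant.
  set S : ℕ → ℝ := fun i => ∑ j ∈ range i, g j with hS
  have hD := dirichlet_sum_sq_le hn S (by simp [hS]) hg
  have hSs : ∀ i, S (i + 1) = S i + g i := fun i => sum_range_succ _ _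
  simp only [hSs, add_sub_cancel_left] at hD
  set c := 2 - 2 * Real.cos (Real.pi / n) with hc
  have hc0 : 0 < c := by have := cos_pi_div_lt_one hn; linarith
  have parts : ∀ k, ∑ i ∈ range (k + 1), g i ^ 2
      = S (k + 1) * g k - ∑ i ∈ range k, S (i + 1) * (g (i + 1) - g i) := by
    intro k
    induction k with
    | zero => simp [hS, sq]
    | succ k ih =>
      rw [sum_range_succ, ih, sum_range_succ _ k, hSs (k + 1)]; ring
  obtain ⟨m, rfl⟩ : ∃ m, n = m + 1 := ⟨n - 1, by omega⟩
  have hp := parts m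
  rw [show S (m + 1) = 0 from hg] at hp
  have h1 : -∑ i ∈ range m, S (i + 1) * (g (i + 1) - g i)
      ≤ ∑ i ∈ range m, (c * S (i + 1) ^ 2 + (g (i + 1) - g i) ^ 2 / c) / 2 := by
    rw [← sum_neg_distrib]
    apply sum_le_sum
    intro i _
    have : (c * S (i + 1) ^ 2 + (g (i + 1) - g i) ^ 2 / c) / 2 + S (i + 1) * (g (i + 1) - g i)
        = (c * S (i + 1) + (g (i + 1) - g i)) ^ 2 / (2 * c) := by
      field_simp; ring
    have h2 : 0 ≤ (c * S (i + 1) + (g (i + 1) - g i)) ^ 2 / (2 * c) := by positivity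
    linarith
  rw [← sum_div, sum_add_distrib, ← mul_sum, ← sum_div] at h1
  rw [sum_range_succ' (fun i => S i ^ 2)] at hD
  have hS0 : S 0 = 0 := by simp [hS]
  rw [hS0] at hD
  simp only [Nat.add_sub_cancel]
  have h3 : ∑ i ∈ range (m + 1), g i ^ 2 ≤ (∑ i ∈ range m, (g (i + 1) - g i) ^ 2) / c := by
    nlinarith
  rw [le_div_iff₀ hc0] at h3
  linarith

/-! ### Energy of monotone sequences -/

/-- A nonnegative-increment sequence: the square of a difference dominates the squares of the
increments and the products of consecutive increments. -/
theorem sq_sub_ge_sum_increments {N : ℕ} (F : ℕ → ℝ) (hF : ∀ k, k + 1 < N → F k ≤ F (k + 1))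
    (i : ℕ) : ∀ j, i ≤ j → j < N →
    ∑ k ∈ Ico i j, (F (k + 1) - F k) ^ 2
      + 2 * ∑ k ∈ Ico i (j - 1), (F (k + 1) - F k) * (F (k + 2) - F (k + 1))
      ≤ (F j - F i) ^ 2 := by
  intro j hij
  induction j, hij using Nat.le_induction with
  | base => intro _; simp
  | succ j hij ih =>
    intro hj
    have ih := ih (by omega)
    rw [sum_Ico_succ_top hij, Nat.add_sub_cancel]
    have hd := hF j hj
    rcases hij.eq_or_lt with rfl | hlt
    · simp
    · obtain ⟨l, rfl⟩ : ∃ l, j = l + 1 := ⟨j - 1, by omega⟩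
      rw [Nat.add_sub_cancel] at ih
      rw [sum_Ico_succ_top (by omega : i ≤ l) (fun k => (F (k + 1) - F k) * _)]
      rw [sum_Ico_succ_top (by omega : i ≤ l)] at ih ⊢
      have hmono : ∀ l, i ≤ l → l < N → F i ≤ F l := by
        intro l hl
        induction l, hl using Nat.le_induction with
        | base => intro _; exact le_rfl
        | succ l _ ih2 => intro h; exact (ih2 (by omega)).trans (hF l h)
      have h1 := hmono l (by omega) (by omega)
      -- Of the cross terms created by the new increment, only the one with its predecessor is kept;
      -- this product is the discarded part.
      have := mul_nonneg (sub_nonneg.2 h1) (sub_nonneg.2 hd)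
      nlinarith

/-- The energy of a monotone sequence in which every cut has weight `2` or `3` alternately, and
consecutive cuts share an edge, dominates `(2 - 2 cos (π / n))` times its square sum. -/
theorem alternating_energy_ge {n : ℕ} (hn : 2 ≤ n) (F : ℕ → ℝ)
    (hsum : ∑ i ∈ range (2 * n), F i = 0) :
    (2 - 2 * Real.cos (Real.pi / n)) * ∑ i ∈ range (2 * n), F i ^ 2
      ≤ ∑ k ∈ range (2 * n - 1), (if Even k then 3 else 2) * (F (k + 1) - F k) ^ 2
        + 2 * ∑ k ∈ range (2 * n - 2), (F (k + 1) - F k) * (F (k + 2) - F (k + 1)) := by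
  have pair : ∀ (u : ℕ → ℝ) (m : ℕ), ∑ i ∈ range (2 * m), u i
      = ∑ i ∈ range m, (u (2 * i) + u (2 * i + 1)) := by
    intro u m
    induction m with
    | zero => simp
    | succ m ih => rw [Nat.mul_succ, sum_range_succ, sum_range_succ, ih, sum_range_succ]; ring
  -- Pair averages form a function of mean zero on a path with `n` vertices.
  set g : ℕ → ℝ := fun i => (F (2 * i) + F (2 * i + 1)) / 2 with hgdef
  have hg : ∑ i ∈ range n, g i = 0 := by
    rw [pair] at hsum
    simp only [hgdef]
    rw [← sum_div, hsum, zero_div]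
  have hP := path_poincare hn g hg
  set c := 2 - 2 * Real.cos (Real.pi / n) with hc
  -- The square sum exceeds twice that of `g` by half the squared within-pair increments; `c ≤ 2`
  -- lets the energy left over pay for this.
  have hc2 : c ≤ 2 := by
    have hn2 : (2 : ℝ) ≤ n := by exact_mod_cast hn
    have : 0 ≤ Real.cos (Real.pi / n) := by
      apply Real.cos_nonneg_of_neg_pi_div_two_le_of_le
      · have := Real.pi_pos
        have : 0 ≤ Real.pi / n := by positivity
        linarith
      · exact div_le_div_of_nonneg_left Real.pi_pos.le (by norm_num) hn2
    linarith
  obtain ⟨m, rfl⟩ : ∃ m, n = m + 1 := ⟨n - 1, by omega⟩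
  simp only [Nat.add_sub_cancel] at hP
  rw [show 2 * (m + 1) - 1 = 2 * m + 1 by omega, show 2 * (m + 1) - 2 = 2 * m by omega,
    sum_range_succ, pair, pair, pair]
  have e1 : ∀ i, (if Even (2 * i) then (3 : ℝ) else 2) = 3 := fun i => by simp
  have e2 : ∀ i, (if Even (2 * i + 1) then (3 : ℝ) else 2) = 2 := fun i => by
    rw [if_neg]; simp
  simp only [e1, e2]
  have h1 : ∑ i ∈ range (m + 1), (F (2 * i) ^ 2 + F (2 * i + 1) ^ 2)
      = 2 * ∑ i ∈ range (m + 1), g i ^ 2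
        + 1 / 2 * ∑ i ∈ range (m + 1), (F (2 * i + 1) - F (2 * i)) ^ 2 := by
    rw [mul_sum, mul_sum, ← sum_add_distrib]
    refine sum_congr rfl fun i _ => ?_
    simp only [hgdef]; ring
  -- The extra square of the last within-pair increment is carried to the next step. There the two
  -- sides differ by half the square of the difference of neighbouring within-pair increments.
  have h2 : ∀ M, 2 * ∑ i ∈ range M, (g (i + 1) - g i) ^ 2
      + ∑ i ∈ range (M + 1), (F (2 * i + 1) - F (2 * i)) ^ 2
      + (F (2 * M + 1) - F (2 * M)) ^ 2
      ≤ ∑ i ∈ range M, (3 * (F (2 * i + 1) - F (2 * i)) ^ 2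
          + 2 * (F (2 * i + 1 + 1) - F (2 * i + 1)) ^ 2)
        + 3 * (F (2 * M + 1) - F (2 * M)) ^ 2
        + 2 * ∑ i ∈ range M, ((F (2 * i + 1) - F (2 * i)) * (F (2 * i + 2) - F (2 * i + 1))
          + (F (2 * i + 1 + 1) - F (2 * i + 1)) * (F (2 * i + 1 + 2) - F (2 * i + 1 + 1))) := by
    intro M
    induction M with
    | zero => simp; nlinarith [sq_nonneg (F 1 - F 0)]
    | succ M ih =>
      rw [sum_range_succ _ (M + 1)]
      iterate 3 rw [sum_range_succ _ M]
      rw [sum_range_succ _ M] at ih ⊢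
      have hD : g (M + 1) - g M
          = (F (2 * M + 2) + F (2 * M + 3)) / 2 - (F (2 * M) + F (2 * M + 1)) / 2 := rfl
      rw [hD]
      simp only [show 2 * (M + 1) = 2 * M + 2 by ring,
        show 2 * M + 2 + 1 = 2 * M + 3 by ring, show 2 * M + 1 + 1 = 2 * M + 2 by ring] at ih ⊢
      nlinarith [sq_nonneg ((F (2 * M + 1) - F (2 * M)) - (F (2 * M + 3) - F (2 * M + 2)))]
  have h3 := h2 m
  rw [h1]
  have h4 : 0 ≤ ∑ i ∈ range (m + 1), (F (2 * i + 1) - F (2 * i)) ^ 2 :=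
    sum_nonneg fun _ _ => sq_nonneg _
  have h5 := mul_nonneg (sub_nonneg.2 hc2) h4
  have h6 := sq_nonneg (F (2 * m + 1) - F (2 * m))
  nlinarith

/-! ### Edge cuts of cubic bipartite graphs -/

/-- The Dirichlet energy of a function on the vertices of a graph. -/
noncomputable def SimpleGraph.energy {V : Type*} [Fintype V] (G : SimpleGraph V)
    [DecidableRel G.Adj] (f : V → ℝ) : ℝ :=
  (∑ u, ∑ v, if G.Adj u v then (f u - f v) ^ 2 else 0) / 2

/-- The ordered pairs of adjacent vertices leading out of a set of vertices. -/
def SimpleGraph.cutPairs {V : Type*} [Fintype V] [DecidableEq V] (G : SimpleGraph V)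
    [DecidableRel G.Adj] (S : Finset V) : Finset (V × V) :=
  {p ∈ S ×ˢ Sᶜ | G.Adj p.1 p.2}

theorem sum_signs_bound_and_parity {ι : Type*} (T : Finset ι) (s : ι → ℤ)
    (hs : ∀ i, s i = 1 ∨ s i = -1) : |∑ i ∈ T, s i| ≤ #T ∧ (∑ i ∈ T, s i) % 2 = (#T : ℤ) % 2 := by
  classical
  induction T using Finset.induction_on with
  | empty => simp
  | insert a T ha ih =>
    rw [sum_insert ha, card_insert_of_notMem ha]
    obtain ⟨h1, h2⟩ := ih
    rw [abs_le] at h1 ⊢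
    push_cast
    rcases hs a with h | h <;> rw [h] <;> omega

/-- Edge cuts of a connected cubic bipartite graph have at least two edges, and at least three if
one of the sides is odd. -/
theorem SimpleGraph.two_le_card_cutPairs {V : Type*} [Fintype V] [DecidableEq V]
    {G : SimpleGraph V} [DecidableRel G.Adj] (hc : G.Connected) (hr : G.IsRegularOfDegree 3)
    (hb : G.IsBipartite) (S : Finset V) (hS : S.Nonempty) (hS' : Sᶜ.Nonempty) :
    2 ≤ #(G.cutPairs S) ∧ (Odd #S → 3 ≤ #(G.cutPairs S)) := by
  obtain ⟨C⟩ := hb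
  -- Sign vertices by colour and sum over edges at `S`: inner edges cancel, so the signed size of
  -- the cut is three times the signed size of `S`.
  set s : V → ℤ := fun v => if C v = 0 then 1 else -1 with hsdef
  have hs : ∀ v, s v = 1 ∨ s v = -1 := fun v => by
    simp only [hsdef]; split_ifs <;> simp
  have hanti : ∀ u v, G.Adj u v → s u = -s v := by
    intro u v h
    have := C.valid h
    simp only [hsdef]
    generalize C u = a at *
    generalize C v = b at *
    fin_cases a <;> fin_cases b <;> simp_all
  have h1 : ∑ u ∈ S, ∑ v, (if G.Adj u v then s u else 0) = 3 * ∑ u ∈ S, s u := by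
    rw [mul_sum]
    refine sum_congr rfl fun u _ => ?_
    rw [← sum_filter, sum_const, ← G.neighborFinset_eq_filter, G.card_neighborFinset_eq_degree, hr u]
    simp
  have h2 : ∑ u ∈ S, ∑ v ∈ S, (if G.Adj u v then s u else 0) = 0 := by
    have : ∑ u ∈ S, ∑ v ∈ S, (if G.Adj u v then s u else 0)
        = -∑ u ∈ S, ∑ v ∈ S, (if G.Adj u v then s u else 0) := by
      conv_lhs => rw [sum_comm]
      rw [← sum_neg_distrib]
      refine sum_congr rfl fun u _ => ?_
      rw [← sum_neg_distrib]
      refine sum_congr rfl fun v _ => ?_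
      by_cases h : G.Adj u v
      · rw [if_pos h, if_pos h.symm, hanti u v h, neg_neg]
      · rw [if_neg h, if_neg (fun h' => h h'.symm), neg_zero]
    omega
  have h3 : ∑ u ∈ S, ∑ v ∈ Sᶜ, (if G.Adj u v then s u else 0) = ∑ p ∈ G.cutPairs S, s p.1 := by
    rw [SimpleGraph.cutPairs, sum_filter, sum_product]
  have h4 : ∑ p ∈ G.cutPairs S, s p.1 = 3 * ∑ u ∈ S, s u := by
    rw [← h1, ← h3]
    simp only [← sum_add_sum_compl S (fun v => if G.Adj _ v then s _ else 0), sum_add_distrib, h2,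
      zero_add]
  obtain ⟨a1, a2⟩ := sum_signs_bound_and_parity (G.cutPairs S) (fun p => s p.1) (fun p => hs p.1)
  obtain ⟨b1, b2⟩ := sum_signs_bound_and_parity S s hs
  have hpos : 0 < #(G.cutPairs S) := by
    obtain ⟨u, hu⟩ := hS
    obtain ⟨v, hv⟩ := hS'
    obtain ⟨w⟩ := hc.preconnected u v
    obtain ⟨d, -, hd1, hd2⟩ := w.exists_boundary_dart (S : Set V) hu (by simpa using hv)
    refine card_pos.2 ⟨(d.fst, d.snd), ?_⟩
    simp only [SimpleGraph.cutPairs, mem_filter, mem_product, mem_compl]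
    exact ⟨⟨by simpa using hd1, by simpa using hd2⟩, d.adj⟩
  rw [h4] at a1 a2
  rw [abs_le] at a1
  -- The cut has the parity of `S`. For even `S` it is nonempty and even; for odd `S` its signed
  -- size is a nonzero multiple of 3.
  refine ⟨by omega, ?_⟩
  rintro ⟨k, hk⟩
  omega

theorem SimpleGraph.energy_eq_sum_lt {N : ℕ} (G : SimpleGraph (Fin N)) [DecidableRel G.Adj]
    (F : Fin N → ℝ) :
    G.energy F = ∑ p : Fin N × Fin N with G.Adj p.1 p.2 ∧ p.1 < p.2, (F p.2 - F p.1) ^ 2 := by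
  rw [sum_filter, Fintype.sum_prod_type]
  have : ∑ u, ∑ v, (if G.Adj u v then (F u - F v) ^ 2 else 0)
      = (∑ u, ∑ v, if G.Adj u v ∧ u < v then (F v - F u) ^ 2 else 0)
        + ∑ u, ∑ v, if G.Adj u v ∧ u < v then (F v - F u) ^ 2 else 0 := by
    conv_rhs => arg 2; rw [sum_comm]
    rw [← sum_add_distrib]
    refine sum_congr rfl fun u _ => ?_
    rw [← sum_add_distrib]
    refine sum_congr rfl fun v _ => ?_
    by_cases h : G.Adj u v
    · rcases lt_or_gt_of_ne h.ne with h1 | h1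
      · simp [h, h1, h1.not_gt, sub_sq_comm (F v)]
      · simp [h, h.symm, h1, h1.not_gt]
    · simp [h, mt SimpleGraph.Adj.symm h]
  rw [SimpleGraph.energy, this]
  ring

/-- The pairs of adjacent vertices that straddle both of two initial segments. -/
def SimpleGraph.crossing {N : ℕ} (G : SimpleGraph (Fin N)) [DecidableRel G.Adj] (k l : ℕ) :
    Finset (Fin N × Fin N) :=
  {p | (G.Adj p.1 p.2 ∧ p.1 < p.2) ∧ (p.1 : ℕ) ≤ k ∧ l < (p.2 : ℕ)}

section Sorted

variable {N : ℕ} {G : SimpleGraph (Fin N)} [DecidableRel G.Adj]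

theorem SimpleGraph.two_le_card_crossing (hc : G.Connected) (hr : G.IsRegularOfDegree 3)
    (hb : G.IsBipartite) (k : ℕ) (hk : k + 1 < N) :
    2 ≤ #(G.crossing k k) ∧ (Even k → 3 ≤ #(G.crossing k k)) := by
  set S : Finset (Fin N) := Finset.Iic ⟨k, by omega⟩ with hS
  have hcard : #S = k + 1 := by simp [hS]
  have hmem : ∀ v : Fin N, v ∈ S ↔ (v : ℕ) ≤ k := fun v => by simp [hS, Fin.le_def]
  have heq : G.crossing k k = G.cutPairs S := by
    ext p
    simp only [SimpleGraph.crossing, SimpleGraph.cutPairs, mem_filter, mem_univ, true_and,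
      mem_product, mem_compl, hmem, Fin.lt_def]
    constructor
    · rintro ⟨⟨h1, h2⟩, h3, h4⟩; exact ⟨⟨h3, by omega⟩, h1⟩
    · rintro ⟨⟨h3, h4⟩, h1⟩; exact ⟨⟨h1, by omega⟩, h3, by omega⟩
  rw [heq]
  obtain ⟨h1, h2⟩ := SimpleGraph.two_le_card_cutPairs hc hr hb S ⟨⟨k, by omega⟩, (hmem _).2 le_rfl⟩
    ⟨⟨k + 1, hk⟩, by simp [hmem]⟩
  -- The segment ending at index `k` has `k + 1` vertices, so even `k` gives an odd side.
  exact ⟨h1, fun h => h2 (by rw [hcard]; exact h.add_one)⟩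

/-- If no edge jumped over vertex `k + 1`, the cuts on its two sides would consist of disjoint sets
of edges at that vertex, at least 2 + 2 of them, against degree 3. -/
theorem SimpleGraph.one_le_card_crossing_succ (hc : G.Connected) (hr : G.IsRegularOfDegree 3)
    (hb : G.IsBipartite) (k : ℕ) (hk : k + 2 < N) : 1 ≤ #(G.crossing k (k + 1)) := by
  by_contra! h
  have hemp : G.crossing k (k + 1) = ∅ := card_eq_zero.1 (by omega)
  have hno : ∀ u v : Fin N, G.Adj u v → u < v → (u : ℕ) ≤ k → ¬ k + 1 < (v : ℕ) := by
    intro u v h1 h2 h3 h4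
    have : (u, v) ∈ G.crossing k (k + 1) := by
      simp only [SimpleGraph.crossing, mem_filter, mem_univ, true_and]
      exact ⟨⟨h1, h2⟩, h3, h4⟩
    rw [hemp] at this
    simp at this
  set w : Fin N := ⟨k + 1, by omega⟩ with hw
  have c1 := (SimpleGraph.two_le_card_crossing hc hr hb k (by omega)).1
  have c2 := (SimpleGraph.two_le_card_crossing hc hr hb (k + 1) (by omega)).1
  have d1 : #(G.crossing k k) ≤ #{u ∈ G.neighborFinset w | u < w} := by
    have hsnd : ∀ p ∈ G.crossing k k, p.2 = w := by
      intro p hp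
      simp only [SimpleGraph.crossing, mem_filter, mem_univ, true_and] at hp
      have := hno _ _ hp.1.1 hp.1.2 hp.2.1
      exact Fin.ext (by simp only [hw]; omega)
    apply card_le_card_of_injOn Prod.fst
    · intro p hp
      have h2 := hsnd p hp
      simp only [SimpleGraph.crossing, coe_filter, Set.mem_ofPred_eq, mem_univ, true_and] at hp
      simp only [coe_filter, Set.mem_ofPred_eq, SimpleGraph.mem_neighborFinset]
      rw [h2] at hp
      exact ⟨hp.1.1.symm, hp.1.2⟩
    · intro p hp q hq hpq
      exact Prod.ext hpq ((hsnd p hp).trans (hsnd q hq).symm)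
  have d2 : #(G.crossing (k + 1) (k + 1)) ≤ #{u ∈ G.neighborFinset w | ¬ u < w} := by
    have hfst : ∀ p ∈ G.crossing (k + 1) (k + 1), p.1 = w := by
      intro p hp
      simp only [SimpleGraph.crossing, mem_filter, mem_univ, true_and] at hp
      have hgt : ¬ (p.1 : ℕ) ≤ k := fun h => hno _ _ hp.1.1 hp.1.2 h hp.2.2
      exact Fin.ext (by simp only [hw]; omega)
    apply card_le_card_of_injOn Prod.snd
    · intro p hp
      have h2 := hfst p hp
      simp only [SimpleGraph.crossing, coe_filter, Set.mem_ofPred_eq, mem_univ, true_and] at hp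
      simp only [coe_filter, Set.mem_ofPred_eq, SimpleGraph.mem_neighborFinset]
      rw [h2] at hp
      exact ⟨hp.1.1, hp.1.2.not_gt⟩
    · intro p hp q hq hpq
      exact Prod.ext ((hfst p hp).trans (hfst q hq).symm) hpq
  have d3 := card_filter_add_card_filter_not (s := G.neighborFinset w) (fun u => u < w)
  have d4 : #(G.neighborFinset w) = 3 := by
    rw [SimpleGraph.card_neighborFinset_eq_degree]; exact hr w
  omega

end Sorted

/-! ### Energy lower bound by sorting -/

/-- Energy bound for a monotone function on a cubic bipartite graph on `Fin (2 * n)`. -/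
theorem SimpleGraph.energy_ge_of_monotone {n : ℕ} (hn : 2 ≤ n) {G : SimpleGraph (Fin (2 * n))}
    [DecidableRel G.Adj] (hc : G.Connected) (hr : G.IsRegularOfDegree 3) (hb : G.IsBipartite)
    (F : Fin (2 * n) → ℝ) (hF : Monotone F) (hsum : ∑ i, F i = 0) :
    (2 - 2 * Real.cos (Real.pi / n)) * ∑ i, F i ^ 2 ≤ G.energy F := by
  set F' : ℕ → ℝ := fun k => if h : k < 2 * n then F ⟨k, h⟩ else 0 with hF'
  have hFF : ∀ i : Fin (2 * n), F i = F' i := fun i => by simp [hF']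
  have hmono : ∀ k, k + 1 < 2 * n → F' k ≤ F' (k + 1) := by
    intro k hk
    simp only [hF', dif_pos hk, dif_pos (show k < 2 * n by omega)]
    exact hF (Fin.le_def.2 (Nat.le_succ k))
  have hs0 : ∑ i ∈ range (2 * n), F' i = 0 := by
    rw [← hsum, ← Fin.sum_univ_eq_sum_range]
    exact sum_congr rfl fun i _ => (hFF i).symm
  have hs2 : ∑ i, F i ^ 2 = ∑ i ∈ range (2 * n), F' i ^ 2 := by
    rw [← Fin.sum_univ_eq_sum_range (fun i => F' i ^ 2)]
    exact sum_congr rfl fun i _ => by rw [hFF i]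
  rw [hs2, SimpleGraph.energy_eq_sum_lt]
  refine (alternating_energy_ge hn F' hs0).trans ?_
  set P : Finset (Fin (2 * n) × Fin (2 * n)) := {p | G.Adj p.1 p.2 ∧ p.1 < p.2} with hP
  -- Each edge is charged to the increments it spans; exchanging the sums then turns the
  -- coefficients into crossing counts.
  have hedge : ∀ p ∈ P,
      ∑ k ∈ range (2 * n - 1), (if (p.1 : ℕ) ≤ k ∧ k < p.2 then (F' (k + 1) - F' k) ^ 2 else 0)
        + 2 * ∑ k ∈ range (2 * n - 2), (if (p.1 : ℕ) ≤ k ∧ k + 1 < p.2 then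
          (F' (k + 1) - F' k) * (F' (k + 2) - F' (k + 1)) else 0)
      ≤ (F p.2 - F p.1) ^ 2 := by
    intro p hp
    have hlt : p.1 < p.2 := by simp only [hP, mem_filter] at hp; exact hp.2.2
    have := p.2.isLt
    rw [← sum_filter, ← sum_filter, hFF, hFF]
    refine le_of_eq_of_le ?_ (sq_sub_ge_sum_increments F' hmono p.1 p.2 hlt.le this)
    congr 2
    · ext k; simp only [mem_filter, mem_range, mem_Ico]; omega
    · congr 1; ext k; simp only [mem_filter, mem_range, mem_Ico]; omega
  refine le_trans ?_ (sum_le_sum hedge)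
  rw [sum_add_distrib, ← mul_sum, sum_comm, sum_comm (s := P)]
  have hcr : ∀ k l (x : ℝ), ∑ p ∈ P, (if (p.1 : ℕ) ≤ k ∧ l < (p.2 : ℕ) then x else 0)
      = #(G.crossing k l) * x := by
    intro k l x
    rw [← sum_filter, sum_const, nsmul_eq_mul, hP, filter_filter]
    rfl
  simp only [hcr]
  have hd : ∀ k, k + 1 < 2 * n → 0 ≤ F' (k + 1) - F' k := fun k hk => sub_nonneg.2 (hmono k hk)
  refine add_le_add (sum_le_sum fun k hk => ?_)
    (mul_le_mul_of_nonneg_left (sum_le_sum fun k hk => ?_) zero_le_two)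
  · rw [mem_range] at hk
    obtain ⟨h1, h2⟩ := SimpleGraph.two_le_card_crossing hc hr hb k (by omega)
    refine mul_le_mul_of_nonneg_right ?_ (sq_nonneg _)
    split_ifs with h
    · exact_mod_cast h2 h
    · exact_mod_cast h1
  · rw [mem_range] at hk
    have h1 := SimpleGraph.one_le_card_crossing_succ hc hr hb k (by omega)
    have h1' : (1 : ℝ) ≤ #(G.crossing k (k + 1)) := by exact_mod_cast h1
    exact le_mul_of_one_le_left (mul_nonneg (hd k (by omega)) (hd (k + 1) (by omega))) h1'

theorem SimpleGraph.energy_comap {V W : Type*} [Fintype V] [Fintype W] (G : SimpleGraph V)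
    [DecidableRel G.Adj] (e : W ≃ V) [DecidableRel (G.comap e).Adj] (f : V → ℝ) :
    (G.comap e).energy (f ∘ e) = G.energy f := by
  simp only [SimpleGraph.energy, SimpleGraph.comap_adj, Function.comp]
  congr 1
  rw [← e.sum_comp]
  refine sum_congr rfl fun u _ => ?_
  rw [← e.sum_comp]

theorem SimpleGraph.comap_equiv_connected_regular_bipartite {V W : Type*} [Fintype V] [Fintype W]
    {G : SimpleGraph V} [DecidableRel G.Adj] (e : W ≃ V) [DecidableRel (G.comap e).Adj] {k : ℕ}
    (hc : G.Connected) (hr : G.IsRegularOfDegree k) (hb : G.IsBipartite) :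
    (G.comap e).Connected ∧ (G.comap e).IsRegularOfDegree k ∧ (G.comap e).IsBipartite := by
  let i : G.comap e ≃g G := SimpleGraph.Iso.comap e G
  refine ⟨i.connected_iff.2 hc, fun v => ?_, hb.of_hom i.toHom⟩
  rw [← hr (i v)]
  exact (i.degree_eq v).symm

/-- Energy bound for any function with zero mean on a cubic bipartite graph. -/
theorem SimpleGraph.energy_ge_of_sum_eq_zero {n : ℕ} (hn : 2 ≤ n) {G : SimpleGraph (Fin (2 * n))}
    [DecidableRel G.Adj] (hc : G.Connected) (hr : G.IsRegularOfDegree 3) (hb : G.IsBipartite)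
    (f : Fin (2 * n) → ℝ) (hsum : ∑ i, f i = 0) :
    (2 - 2 * Real.cos (Real.pi / n)) * ∑ i, f i ^ 2 ≤ G.energy f := by
  classical
  set σ := Tuple.sort f
  obtain ⟨h1, h2, h3⟩ := SimpleGraph.comap_equiv_connected_regular_bipartite σ hc hr hb
  rw [← SimpleGraph.energy_comap G σ, ← Equiv.sum_comp σ]
  refine SimpleGraph.energy_ge_of_monotone hn h1 h2 h3 (f ∘ σ) (Tuple.monotone_sort f) ?_
  rw [← hsum]
  exact Equiv.sum_comp σ f

/-! ### The spectral gap as a Rayleigh quotient -/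

section Spectral

open Matrix

/-- Spectral decomposition of a real symmetric matrix in terms of dot products, with the
eigenvalues in non-increasing order. -/
theorem Matrix.IsHermitian.exists_sorted_eigenbasis {V : Type*} [Fintype V] [DecidableEq V]
    {A : Matrix V V ℝ} (hA : A.IsHermitian) :
    ∃ u : Fin (Fintype.card V) → V → ℝ,
      (∀ i j, u i ⬝ᵥ u j = if i = j then 1 else 0) ∧
      (∀ i, A *ᵥ u i = hA.eigenvalues₀ i • u i) ∧
      (∀ f g : V → ℝ, ∑ i, (u i ⬝ᵥ f) * (u i ⬝ᵥ g) = f ⬝ᵥ g) := by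
  set e : Fin (Fintype.card V) ≃ V := Fintype.equivOfCardEq (Fintype.card_fin _) with he
  have hin : ∀ x y : EuclideanSpace ℝ V, inner ℝ x y = (x : V → ℝ) ⬝ᵥ (y : V → ℝ) := by
    intro x y
    simp [PiLp.inner_apply, dotProduct, mul_comm]
  refine ⟨fun i => hA.eigenvectorBasis (e i), fun i j => ?_, fun i => ?_, fun f g => ?_⟩
  · rw [← hin, orthonormal_iff_ite.1 hA.eigenvectorBasis.orthonormal]
    simp
  · rw [hA.mulVec_eigenvectorBasis, Matrix.IsHermitian.eigenvalues]
    simp [he]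
  · have := hA.eigenvectorBasis.sum_inner_mul_inner (WithLp.toLp 2 f) (WithLp.toLp 2 g)
    rw [e.sum_comp (fun v => ((hA.eigenvectorBasis v : V → ℝ) ⬝ᵥ f)
      * ((hA.eigenvectorBasis v : V → ℝ) ⬝ᵥ g))]
    simp only [hin] at this
    rw [← this]
    exact sum_congr rfl fun v _ => by rw [dotProduct_comm]

variable {V : Type*} [Fintype V] {G : SimpleGraph V} [DecidableRel G.Adj] {d : ℕ}

theorem SimpleGraph.IsRegularOfDegree.energy_eq (hr : G.IsRegularOfDegree d) (f : V → ℝ) :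
    G.energy f = d * (f ⬝ᵥ f) - f ⬝ᵥ (G.adjMatrix ℝ *ᵥ f) := by
  have h1 : ∀ g : V → ℝ, ∑ u, ∑ v, (if G.Adj u v then g u else 0) = d * ∑ u, g u := by
    intro g
    rw [mul_sum]
    refine sum_congr rfl fun u _ => ?_
    rw [← sum_filter, sum_const, ← G.neighborFinset_eq_filter, G.card_neighborFinset_eq_degree, hr u,
      nsmul_eq_mul]
  have h2 : ∑ u, ∑ v, (if G.Adj u v then f v ^ 2 else 0) = d * ∑ u, f u ^ 2 := by
    rw [sum_comm, ← h1]
    simp only [G.adj_comm]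
  have h3 : f ⬝ᵥ (G.adjMatrix ℝ *ᵥ f) = ∑ u, ∑ v, if G.Adj u v then f u * f v else 0 := by
    simp [dotProduct, mulVec, mul_sum, SimpleGraph.adjMatrix_apply]
  have h4 : f ⬝ᵥ f = ∑ u, f u ^ 2 := by simp [dotProduct, sq]
  have h5 : ∑ u, ∑ v, (if G.Adj u v then (f u - f v) ^ 2 else 0)
      = ∑ u, ∑ v, (if G.Adj u v then f u ^ 2 else 0)
        + ∑ u, ∑ v, (if G.Adj u v then f v ^ 2 else 0)
        - 2 * ∑ u, ∑ v, if G.Adj u v then f u * f v else 0 := by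
    simp only [mul_sum, ← sum_add_distrib, ← sum_sub_distrib]
    refine sum_congr rfl fun u _ => sum_congr rfl fun v _ => ?_
    split_ifs <;> ring
  rw [SimpleGraph.energy, h5, h1 (fun u => f u ^ 2), h2, h3, h4]
  ring

theorem SimpleGraph.energy_nonneg (f : V → ℝ) : 0 ≤ G.energy f :=
  div_nonneg (sum_nonneg fun _ _ => sum_nonneg fun _ _ => by split_ifs <;> positivity) two_pos.le

theorem SimpleGraph.Connected.eq_of_energy_eq_zero (hc : G.Connected) {f : V → ℝ}
    (h : G.energy f = 0) (u v : V) : f u = f v := by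
  have h0 : ∀ u v, G.Adj u v → f u = f v := by
    intro u v huv
    rw [SimpleGraph.energy, div_eq_zero_iff, or_iff_left two_ne_zero,
      sum_eq_zero_iff_of_nonneg fun _ _ => sum_nonneg fun _ _ => by split_ifs <;> positivity] at h
    have h1 := h u (mem_univ u)
    rw [sum_eq_zero_iff_of_nonneg fun _ _ => by split_ifs <;> positivity] at h1
    have h2 := h1 v (mem_univ v)
    rw [if_pos huv, sq_eq_zero_iff, sub_eq_zero] at h2
    exact h2
  obtain ⟨w⟩ := hc.preconnected u v
  induction w with
  | nil => rfl
  | cons huv _ ih => exact (h0 _ _ huv).trans ih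

/-- Variational characterization of the spectral gap of a connected regular graph. -/
theorem SimpleGraph.spectralGap_variational [DecidableEq V] (hV : 1 < Fintype.card V) (hc : G.Connected)
    (hr : G.IsRegularOfDegree d) :
    (∃ f : V → ℝ, ∑ v, f v = 0 ∧ ∑ v, f v ^ 2 = 1 ∧ G.energy f = G.spectralGap) ∧
      ∀ f : V → ℝ, ∑ v, f v = 0 → G.spectralGap * ∑ v, f v ^ 2 ≤ G.energy f := by
  obtain ⟨u, hu, hev, hpar⟩ := G.adjMatrix_real_isHermitian.exists_sorted_eigenbasis
  set l := G.adjMatrix_real_isHermitian.eigenvalues₀ with hl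
  have hanti : Antitone l := G.adjMatrix_real_isHermitian.eigenvalues₀_antitone
  set i0 : Fin (Fintype.card V) := ⟨0, Nat.zero_lt_of_lt hV⟩ with hi0
  set i1 : Fin (Fintype.card V) := ⟨1, hV⟩ with hi1
  have hgap : G.spectralGap = l i0 - l i1 := by rw [SimpleGraph.spectralGap, dif_pos hV]
  have huu : ∀ i, u i ⬝ᵥ u i = 1 := fun i => by rw [hu, if_pos rfl]
  have hen : ∀ i, G.energy (u i) = d - l i := by
    intro i
    rw [hr.energy_eq, hev, dotProduct_smul, huu]
    simp
  have hle : ∀ i, l i ≤ d := fun i => by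
    have := hen i ▸ SimpleGraph.energy_nonneg (G := G) (u i)
    linarith
  have hAdot : ∀ i (f : V → ℝ), u i ⬝ᵥ (G.adjMatrix ℝ *ᵥ f) = l i * (u i ⬝ᵥ f) := by
    intro i f
    rw [dotProduct_mulVec, ← mulVec_transpose, G.transpose_adjMatrix, hev, smul_dotProduct,
      smul_eq_mul]
  have hone : G.adjMatrix ℝ *ᵥ (fun _ => (1 : ℝ)) = (d : ℝ) • fun _ => (1 : ℝ) := by
    ext v
    have := SimpleGraph.adjMatrix_mulVec_const_apply_of_regular (a := (1 : ℝ)) hr (v := v)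
    simpa [Function.const_def] using this
  -- If the top eigenvalue were below `d`, the constant eigenvector would be orthogonal to the whole
  -- eigenbasis, contradicting Parseval.
  have hl0 : l i0 = d := by
    refine le_antisymm (hle i0) ?_
    by_contra! hlt
    have hz : ∀ i, u i ⬝ᵥ (fun _ => (1 : ℝ)) = 0 := by
      intro i
      have h1 := hAdot i (fun _ => 1)
      rw [hone, dotProduct_smul, smul_eq_mul] at h1
      have h2 : l i ≤ l i0 := hanti (Nat.zero_le _)
      have h3 : (d - l i) * (u i ⬝ᵥ fun _ => (1 : ℝ)) = 0 := by linarith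
      rcases mul_eq_zero.1 h3 with h | h
      · linarith
      · exact h
    have h4 := hpar (fun _ => 1) (fun _ => 1)
    simp only [hz] at h4
    simp only [dotProduct, mul_zero, sum_const_zero, mul_one, sum_const, card_univ,
      nsmul_eq_mul] at h4
    have h5 : Fintype.card V = 0 := by exact_mod_cast h4.symm
    omega
  -- The top eigenvector has zero energy, hence is constant; orthogonality to it therefore means
  -- mean zero.
  have hconst : ∀ v w, u i0 v = u i0 w :=
    fun v w => hc.eq_of_energy_eq_zero (by rw [hen, hl0, sub_self]) v w
  have hdot0 : ∀ (f : V → ℝ) (v : V), u i0 ⬝ᵥ f = u i0 v * ∑ w, f w := by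
    intro f v
    rw [dotProduct, mul_sum]
    exact sum_congr rfl fun w _ => by rw [hconst w v]
  obtain ⟨v0⟩ := hc.nonempty
  have hu0 : u i0 v0 ≠ 0 := by
    intro h
    have := huu i0
    rw [hdot0 _ v0, h, zero_mul] at this
    exact zero_ne_one this
  have hsq : ∀ f : V → ℝ, f ⬝ᵥ f = ∑ v, f v ^ 2 := fun f => by simp [dotProduct, sq]
  refine ⟨⟨u i1, ?_, ?_, ?_⟩, fun f hf => ?_⟩
  · have h1 := hu i0 i1
    rw [hdot0 _ v0, if_neg (by simp [hi0, hi1])] at h1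
    exact (mul_eq_zero.1 h1).resolve_left hu0
  · rw [← hsq, huu]
  · rw [hen, hgap, hl0]
  · have hf0 : u i0 ⬝ᵥ f = 0 := by rw [hdot0 _ v0, hf, mul_zero]
    rw [hr.energy_eq, ← hsq, hgap, hl0]
    have h1 : f ⬝ᵥ (G.adjMatrix ℝ *ᵥ f) ≤ l i1 * (f ⬝ᵥ f) := by
      rw [← hpar, ← hpar f f, mul_sum]
      refine sum_le_sum fun i _ => ?_
      rw [hAdot]
      by_cases h : i = i0
      · rw [h, hf0]; simp
      · have h2 : l i ≤ l i1 := by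
          apply hanti
          rw [Fin.le_def]
          have : (i : ℕ) ≠ 0 := fun h' => h (Fin.ext h')
          simp only [hi1]; omega
        nlinarith [mul_self_nonneg (u i ⬝ᵥ f)]
    linarith

end Spectral

/-! ### Bipartite doubles and closed ladders -/

/-- The bipartite graph on two copies of `Fin n` whose biadjacency relation is a given symmetric
relation. -/
def bipartiteDouble {n : ℕ} (B : ℕ → ℕ → Prop) (hB : ∀ i j, B i j → B j i) :
    SimpleGraph (Fin n × Bool) where
  Adj p q := p.2 ≠ q.2 ∧ B p.1 q.1
  symm := ⟨fun _ _ h => ⟨h.1.symm, hB _ _ h.2⟩⟩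
  loopless := ⟨fun _ h => h.1 rfl⟩

instance {n : ℕ} (B : ℕ → ℕ → Prop) [DecidableRel B] (hB : ∀ i j, B i j → B j i) :
    DecidableRel (bipartiteDouble (n := n) B hB).Adj :=
  fun p q => inferInstanceAs (Decidable (p.2 ≠ q.2 ∧ B p.1 q.1))

section BipartiteDouble

variable {n : ℕ} {B : ℕ → ℕ → Prop} {hB : ∀ i j, B i j → B j i}

theorem bipartiteDouble_isBipartite : (bipartiteDouble (n := n) B hB).IsBipartite :=
  (SimpleGraph.Coloring.mk (G := bipartiteDouble (n := n) B hB) Prod.snd fun h => h.1).colorable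

theorem bipartiteDouble_connected (hn : 0 < n) (h0 : B 0 0) (hs : ∀ i, i + 1 < n → B i (i + 1)) :
    (bipartiteDouble (n := n) B hB).Connected := by
  have hbase : ∀ a, (bipartiteDouble (n := n) B hB).Reachable (⟨0, hn⟩, a) (⟨0, hn⟩, false) := by
    intro a
    cases a with
    | false => exact .refl _
    | true => exact SimpleGraph.Adj.reachable ⟨by simp, h0⟩
  have hall : ∀ i (hi : i < n) a,
      (bipartiteDouble (n := n) B hB).Reachable (⟨i, hi⟩, a) (⟨0, hn⟩, false) := by
    intro i
    induction i with
    | zero => exact fun _ a => hbase a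
    | succ i ih =>
      intro hi a
      refine .trans (SimpleGraph.Adj.reachable (v := (⟨i, by omega⟩, !a)) ⟨by simp, ?_⟩)
        (ih (by omega) (!a))
      exact hB _ _ (hs i hi)
  have : Nonempty (Fin n × Bool) := ⟨(⟨0, hn⟩, false)⟩
  exact ⟨fun p q => (hall p.1 p.1.2 p.2).trans (hall q.1 q.1.2 q.2).symm⟩

variable [DecidableRel B]

theorem bipartiteDouble_isRegularOfDegree
    (h3 : ∀ i < n, ∃ a b c, a ≠ b ∧ a ≠ c ∧ b ≠ c ∧ a < n ∧ b < n ∧ c < n ∧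
      ∀ j < n, B i j ↔ j = a ∨ j = b ∨ j = c) :
    (bipartiteDouble (n := n) B hB).IsRegularOfDegree 3 := by
  rintro ⟨⟨i, hi⟩, s⟩
  obtain ⟨a, b, c, hab, hac, hbc, ha, hb, hc, hj⟩ := h3 i hi
  rw [← SimpleGraph.card_neighborFinset_eq_degree, card_eq_three]
  refine ⟨(⟨a, ha⟩, !s), (⟨b, hb⟩, !s), (⟨c, hc⟩, !s), by simpa, by simpa, by simpa, ?_⟩
  ext ⟨⟨j, hjn⟩, t⟩
  simp only [SimpleGraph.mem_neighborFinset, mem_insert, mem_singleton, Prod.mk.injEq, Fin.mk.injEq]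
  have : (bipartiteDouble (n := n) B hB).Adj (⟨i, hi⟩, s) (⟨j, hjn⟩, t) ↔ s ≠ t ∧ B i j := Iff.rfl
  rw [this, hj j hjn]
  cases s <;> cases t <;> simp

theorem bipartiteDouble_energy (h : ℕ → ℝ) :
    (bipartiteDouble (n := n) B hB).energy (fun p => h p.1)
      = ∑ i ∈ range n, ∑ j ∈ range n, if B i j then (h i - h j) ^ 2 else 0 := by
  have hadj : ∀ p q : Fin n × Bool, (bipartiteDouble (n := n) B hB).Adj p q
    ↔ p.2 ≠ q.2 ∧ B p.1 q.1 := fun _ _ => Iff.rfl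
  rw [SimpleGraph.energy, ← Fin.sum_univ_eq_sum_range
    (fun i => ∑ j ∈ range n, if B i j then (h i - h j) ^ 2 else 0)]
  simp only [Fintype.sum_prod_type, hadj, Fintype.sum_bool, ← Fin.sum_univ_eq_sum_range]
  rw [sum_div]
  refine sum_congr rfl fun i _ => ?_
  simp only [← sum_add_distrib, sum_div]
  refine sum_congr rfl fun j _ => ?_
  simp only [ne_eq, not_true_eq_false, false_and, if_false, not_false_eq_true,
    true_and, Bool.true_eq_false, Bool.false_eq_true]
  ring

end BipartiteDouble

/-- The biadjacency relation of a ladder closed at both ends by a `K₃,₃` minus an edge. -/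
def closedLadder (n i j : ℕ) : Prop :=
  ((i ≤ j + 1 ∧ j ≤ i + 1) ∧ ¬(i = 2 ∧ j = 2) ∧ ¬(i + 3 = n ∧ j + 3 = n)) ∨
    (i = 0 ∧ j = 2) ∨ (i = 2 ∧ j = 0) ∨ (i + 1 = n ∧ j + 3 = n) ∨ (i + 3 = n ∧ j + 1 = n)

instance (n : ℕ) : DecidableRel (closedLadder n) :=
  fun _ _ => by unfold closedLadder; infer_instance

theorem closedLadder_symm (n i j : ℕ) (h : closedLadder n i j) : closedLadder n j i := by
  unfold closedLadder at *; omega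

/-- The bound `6 ≤ n` keeps the three modified rows at each end disjoint. -/
theorem closedLadder_rows {n : ℕ} (hn : 6 ≤ n) (i : ℕ) (hi : i < n) :
    ∃ a b c, a ≠ b ∧ a ≠ c ∧ b ≠ c ∧ a < n ∧ b < n ∧ c < n ∧
      ∀ j < n, closedLadder n i j ↔ j = a ∨ j = b ∨ j = c := by
  unfold closedLadder
  by_cases h0 : i ≤ 1
  · exact ⟨0, 1, 2, by omega, by omega, by omega, by omega, by omega, by omega, by omega⟩
  by_cases h2 : i = 2
  · exact ⟨0, 1, 3, by omega, by omega, by omega, by omega, by omega, by omega, by omega⟩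
  by_cases h3 : i + 3 = n
  · exact ⟨n - 1, n - 2, n - 4, by omega, by omega, by omega, by omega, by omega, by omega,
      by omega⟩
  by_cases h4 : n ≤ i + 2
  · exact ⟨n - 1, n - 2, n - 3, by omega, by omega, by omega, by omega, by omega, by omega,
      by omega⟩
  · exact ⟨i - 1, i, i + 1, by omega, by omega, by omega, by omega, by omega, by omega,
      by omega⟩

/-- The biadjacency relation of the prism or Möbius ladder. -/
def closedCycle (n i j : ℕ) : Prop :=
  (i ≤ j + 1 ∧ j ≤ i + 1) ∨ (i = 0 ∧ j + 1 = n) ∨ (i + 1 = n ∧ j = 0)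

instance (n : ℕ) : DecidableRel (closedCycle n) :=
  fun _ _ => by unfold closedCycle; infer_instance

theorem closedCycle_symm (n i j : ℕ) (h : closedCycle n i j) : closedCycle n j i := by
  unfold closedCycle at *; omega

theorem closedCycle_rows {n : ℕ} (hn : 3 ≤ n) (i : ℕ) (hi : i < n) :
    ∃ a b c, a ≠ b ∧ a ≠ c ∧ b ≠ c ∧ a < n ∧ b < n ∧ c < n ∧
      ∀ j < n, closedCycle n i j ↔ j = a ∨ j = b ∨ j = c := by
  unfold closedCycle
  by_cases h0 : i = 0
  · exact ⟨0, 1, n - 1, by omega, by omega, by omega, by omega, by omega, by omega, by omega⟩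
  by_cases h1 : i + 1 = n
  · exact ⟨0, n - 2, n - 1, by omega, by omega, by omega, by omega, by omega, by omega, by omega⟩
  · exact ⟨i - 1, i, i + 1, by omega, by omega, by omega, by omega, by omega, by omega,
      by omega⟩

/-- Diagonal entries contribute zero, leaving the path steps and the end chords, each in both
orders. An inequality suffices and tolerates coinciding chords when `n = 3`. -/
theorem closedLadder_energy_le {n : ℕ} (hn : 3 ≤ n) (h : ℕ → ℝ) :
    ∑ i ∈ range n, ∑ j ∈ range n, (if closedLadder n i j then (h i - h j) ^ 2 else 0)
      ≤ 2 * ∑ k ∈ range (n - 1), (h (k + 1) - h k) ^ 2 + 2 * (h 2 - h 0) ^ 2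
        + 2 * (h (n - 1) - h (n - 3)) ^ 2 := by
  have hpt : ∀ i ∈ range n, ∀ j ∈ range n, (if closedLadder n i j then (h i - h j) ^ 2 else 0)
      ≤ ((if j = i + 1 then (h j - h i) ^ 2 else 0) + (if i = j + 1 then (h i - h j) ^ 2 else 0))
        + ((if i = 0 then if j = 2 then (h 2 - h 0) ^ 2 else 0 else 0)
          + (if i = 2 then if j = 0 then (h 2 - h 0) ^ 2 else 0 else 0))
        + ((if i = n - 1 then if j = n - 3 then (h (n - 1) - h (n - 3)) ^ 2 else 0 else 0)
          + (if i = n - 3 then if j = n - 1 then (h (n - 1) - h (n - 3)) ^ 2 else 0 else 0)) := by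
    intro i _ j _
    have t1 : 0 ≤ if j = i + 1 then (h j - h i) ^ 2 else 0 := by split_ifs <;> positivity
    have t2 : 0 ≤ if i = j + 1 then (h i - h j) ^ 2 else 0 := by split_ifs <;> positivity
    have t3 : 0 ≤ if i = 0 then if j = 2 then (h 2 - h 0) ^ 2 else 0 else 0 := by
      split_ifs <;> positivity
    have t4 : 0 ≤ if i = 2 then if j = 0 then (h 2 - h 0) ^ 2 else 0 else 0 := by
      split_ifs <;> positivity
    have t5 : 0 ≤ if i = n - 1 then if j = n - 3 then (h (n - 1) - h (n - 3)) ^ 2 else 0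
        else 0 := by split_ifs <;> positivity
    have t6 : 0 ≤ if i = n - 3 then if j = n - 1 then (h (n - 1) - h (n - 3)) ^ 2 else 0
        else 0 := by split_ifs <;> positivity
    by_cases hL : closedLadder n i j
    · rw [if_pos hL]
      rcases hL with ⟨⟨h1, h2⟩, -⟩ | ⟨h1, h2⟩ | ⟨h1, h2⟩ | ⟨h1, h2⟩ | ⟨h1, h2⟩
      · rcases lt_trichotomy i j with hij | rfl | hij
        · rw [if_pos (show j = i + 1 by omega), sub_sq_comm (h i)] at *
          linarith
        · have e : (h i - h i) ^ 2 = 0 := by simp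
          linarith
        · rw [if_pos (show i = j + 1 by omega)] at *
          linarith
      · subst h1 h2
        rw [if_pos rfl, if_pos rfl] at t3 ⊢
        have e := sub_sq_comm (h 0) (h 2)
        linarith
      · subst h1 h2
        rw [if_pos rfl, if_pos rfl] at t4 ⊢
        linarith
      · obtain rfl : i = n - 1 := by omega
        obtain rfl : j = n - 3 := by omega
        rw [if_pos rfl, if_pos rfl] at t5 ⊢
        linarith
      · obtain rfl : i = n - 3 := by omega
        obtain rfl : j = n - 1 := by omega
        rw [if_pos rfl, if_pos rfl] at t6 ⊢
        have e := sub_sq_comm (h (n - 3)) (h (n - 1))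
        linarith
    · rw [if_neg hL]
      linarith
  refine (sum_le_sum fun i hi => sum_le_sum fun j hj => hpt i hi j hj).trans (le_of_eq ?_)
  have hstep : ∑ i ∈ range n, ∑ j ∈ range n, (if j = i + 1 then (h j - h i) ^ 2 else 0)
      = ∑ k ∈ range (n - 1), (h (k + 1) - h k) ^ 2 := by
    obtain ⟨m, rfl⟩ : ∃ m, n = m + 1 := ⟨n - 1, by omega⟩
    rw [sum_range_succ, Nat.add_sub_cancel]
    simp only [sum_ite_eq', mem_range]
    rw [if_neg (lt_irrefl _), add_zero]
    exact sum_congr rfl fun i hi => if_pos (by simpa using hi)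
  have hsingle : ∀ (a b : ℕ) (x : ℝ), a < n → b < n →
      ∑ i ∈ range n, ∑ j ∈ range n, (if i = a then if j = b then x else 0 else 0) = x := by
    intro a b x ha hb
    rw [sum_eq_single_of_mem a (mem_range.2 ha) (fun i _ hi => by simp [hi])]
    simp [hb]
  simp only [sum_add_distrib]
  rw [hsingle 0 2 _ (by omega) (by omega), hsingle 2 0 _ (by omega) (by omega),
    hsingle (n - 1) (n - 3) _ (by omega) (by omega),
    hsingle (n - 3) (n - 1) _ (by omega) (by omega), hstep,
    sum_comm (f := fun i j => if i = j + 1 then (h i - h j) ^ 2 else 0), hstep]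
  ring

/-! ### The cosine test function -/

section CosineTest

variable {n : ℕ}

/-- The values of the fundamental mode of the path with `n` vertices. -/
noncomputable def pathMode (n k : ℕ) : ℝ := Real.cos (Real.pi / n * (k + 1 / 2))

theorem pathMode_reflect {k : ℕ} (hk : k < n) : pathMode n (n - 1 - k) = -pathMode n k := by
  have hn0 : (n : ℝ) ≠ 0 := by exact_mod_cast (by omega : n ≠ 0)
  rw [pathMode, pathMode, ← Real.cos_pi_sub]
  congr 1
  rw [Nat.sub_sub, Nat.cast_sub (by omega)]
  push_cast
  field_simp
  ring

theorem sum_pathMode : ∑ k ∈ range n, pathMode n k = 0 := by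
  have hr := sum_range_reflect (pathMode n) n
  have : ∀ k ∈ range n, pathMode n (n - 1 - k) = -pathMode n k :=
    fun k hk => pathMode_reflect (mem_range.1 hk)
  rw [sum_congr rfl this, sum_neg_distrib] at hr
  linarith

/-- The cosine extends past both ends with equal neighbouring values, so the boundary terms in the
summation by parts vanish: the mode attains equality in `path_poincare`. -/
theorem sum_sq_diff_pathMode (hn : 0 < n) :
    ∑ k ∈ range (n - 1), (pathMode n (k + 1) - pathMode n k) ^ 2
      = (2 - 2 * Real.cos (Real.pi / n)) * ∑ k ∈ range n, pathMode n k ^ 2 := by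
  set θ := Real.pi / n with hθ
  set p : ℕ → ℝ := fun k => Real.cos (θ * (k - 1 / 2)) with hp
  have hps : ∀ k, p (k + 1) = pathMode n k := by
    intro k; simp only [hp, pathMode, ← hθ]; push_cast; ring_nf
  have hrec : ∀ k, p (k + 2) + p k = 2 * Real.cos θ * p (k + 1) := by
    intro k
    simp only [hp]
    rw [show θ * (((k + 2 : ℕ) : ℝ) - 1 / 2) = θ * (((k + 1 : ℕ) : ℝ) - 1 / 2) + θ by
      push_cast; ring, show θ * ((k : ℝ) - 1 / 2) = θ * (((k + 1 : ℕ) : ℝ) - 1 / 2) - θ by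
      push_cast; ring, Real.cos_add, Real.cos_sub]
    ring
  have h01 : p 0 = p 1 := by
    simp only [hp]; rw [← Real.cos_neg]; congr 1; push_cast; ring
  have hnn : p (n + 1) = p n := by
    have hn0 : (n : ℝ) ≠ 0 := by exact_mod_cast hn.ne'
    simp only [hp]
    rw [show θ * (((n + 1 : ℕ) : ℝ) - 1 / 2) = Real.pi + θ / 2 by
        rw [hθ]; push_cast; field_simp; ring,
      show θ * ((n : ℝ) - 1 / 2) = Real.pi - θ / 2 by rw [hθ]; field_simp,
      Real.cos_pi_sub, add_comm, Real.cos_add_pi]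
  have key : ∀ m, ∑ k ∈ range m, (p (k + 2) - p (k + 1)) ^ 2
      = (2 - 2 * Real.cos θ) * ∑ k ∈ range m, p (k + 1) ^ 2
        + p (m + 1) * (p (m + 1) - p m) := by
    intro m
    induction m with
    | zero => simp [h01]
    | succ m ih =>
      rw [sum_range_succ, sum_range_succ, ih]
      linear_combination -p (m + 1) * hrec m
  have h := key n
  rw [hnn, sub_self, mul_zero, add_zero] at h
  obtain ⟨m, rfl⟩ : ∃ m, n = m + 1 := ⟨n - 1, by omega⟩
  simp only [← hps, Nat.add_sub_cancel]
  rw [← h, sum_range_succ, hnn, sub_self]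
  simp

theorem half_le_sum_sq_pathMode (hn : 2 ≤ n) : 1 / 2 ≤ ∑ k ∈ range n, pathMode n k ^ 2 := by
  have h0 : pathMode n 0 ^ 2 ≤ ∑ k ∈ range n, pathMode n k ^ 2 :=
    single_le_sum (f := fun k => pathMode n k ^ 2) (fun _ _ => sq_nonneg _)
      (mem_range.2 (by omega))
  refine le_trans ?_ h0
  have hc : 0 ≤ Real.cos (Real.pi / n) := by
    have hn2 : (2 : ℝ) ≤ n := by exact_mod_cast hn
    have := Real.pi_pos
    apply Real.cos_nonneg_of_neg_pi_div_two_le_of_le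
    · have : 0 ≤ Real.pi / n := by positivity
      linarith
    · exact div_le_div_of_nonneg_left Real.pi_pos.le (by norm_num) hn2
  rw [pathMode, Real.cos_sq]
  rw [show 2 * (Real.pi / n * ((0 : ℕ) + 1 / 2)) = Real.pi / n by push_cast; ring]
  linarith

/-- The difference is a product of two sines, hence quadratic in `π / n`; this flatness makes the
end chords negligible. -/
theorem sq_sub_pathMode_le : (pathMode n 2 - pathMode n 0) ^ 2 ≤ 9 * (Real.pi / n) ^ 4 := by
  set θ := Real.pi / n with hθ
  have hθ0 : 0 ≤ θ := div_nonneg Real.pi_pos.le n.cast_nonneg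
  have h1 : |pathMode n 2 - pathMode n 0| ≤ 3 * θ ^ 2 := by
    rw [pathMode, pathMode, Real.cos_sub_cos, ← hθ]
    rw [show (θ * ((2 : ℕ) + 1 / 2) + θ * ((0 : ℕ) + 1 / 2)) / 2 = 3 / 2 * θ by push_cast; ring,
      show (θ * ((2 : ℕ) + 1 / 2) - θ * ((0 : ℕ) + 1 / 2)) / 2 = θ by push_cast; ring,
      abs_mul, abs_mul]
    have a1 : |Real.sin (3 / 2 * θ)| ≤ 3 / 2 * θ := by
      refine Real.abs_sin_le_abs.trans (abs_of_nonneg (by positivity)).le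
    have a2 : |Real.sin θ| ≤ θ := Real.abs_sin_le_abs.trans (abs_of_nonneg hθ0).le
    have a3 := mul_le_mul a1 a2 (abs_nonneg _) (by positivity)
    rw [abs_neg, abs_two]
    nlinarith
  calc (pathMode n 2 - pathMode n 0) ^ 2 = |pathMode n 2 - pathMode n 0| ^ 2 := (sq_abs _).symm
    _ ≤ (3 * θ ^ 2) ^ 2 := pow_le_pow_left₀ (abs_nonneg _) h1 2
    _ = 9 * θ ^ 4 := by ring

end CosineTest

/-- The constant 36 is four chord terms of at most 9 each; since the square norm is at least 1, they
can be absorbed into it. -/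
theorem closedLadder_energy_pathMode_le {n : ℕ} (hn : 6 ≤ n) :
    (bipartiteDouble (n := n) (closedLadder n) (closedLadder_symm n)).energy
        (fun p => pathMode n p.1)
      ≤ ((Real.pi / n) ^ 2 + 36 * (Real.pi / n) ^ 4) *
        ∑ p : Fin n × Bool, pathMode n p.1 ^ 2 := by
  have hsum : ∑ p : Fin n × Bool, pathMode n p.1 ^ 2 = 2 * ∑ k ∈ range n, pathMode n k ^ 2 := by
    rw [Fintype.sum_prod_type, ← Fin.sum_univ_eq_sum_range (fun k => pathMode n k ^ 2), mul_sum]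
    exact sum_congr rfl fun i _ => by simp
  have e1 : pathMode n (n - 1) = -pathMode n 0 := pathMode_reflect (k := 0) (by omega)
  have e2 : pathMode n (n - 3) = -pathMode n 2 := by
    rw [← pathMode_reflect (k := 2) (by omega), Nat.sub_sub]
  rw [bipartiteDouble_energy, hsum]
  refine (closedLadder_energy_le (by omega) _).trans ?_
  rw [sum_sq_diff_pathMode (by omega), e1, e2]
  have h1 := half_le_sum_sq_pathMode (n := n) (by omega)
  have h2 := sq_sub_pathMode_le (n := n)
  have h3 := Real.one_sub_sq_div_two_le_cos (x := Real.pi / n)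
  set H := ∑ k ∈ range n, pathMode n k ^ 2
  set θ := Real.pi / n
  have h4 : (2 - 2 * Real.cos θ) * H ≤ θ ^ 2 * H :=
    mul_le_mul_of_nonneg_right (by linarith) (by linarith)
  have h5 : 0 ≤ θ ^ 4 * (H - 1 / 2) := mul_nonneg (by positivity) (by linarith)
  nlinarith

/-! ### The minimum gap and its asymptotics -/

/-- A bipartite double on `Fin n × Bool` gives a member of the set of gaps, and test functions on it
bound that gap. -/
theorem bipartiteDouble_gap_mem {n : ℕ} (hn : 3 ≤ n) {B : ℕ → ℕ → Prop} [DecidableRel B]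
    (hB : ∀ i j, B i j → B j i) (h0 : B 0 0) (hs : ∀ i, i + 1 < n → B i (i + 1))
    (h3 : ∀ i < n, ∃ a b c, a ≠ b ∧ a ≠ c ∧ b ≠ c ∧ a < n ∧ b < n ∧ c < n ∧
      ∀ j < n, B i j ↔ j = a ∨ j = b ∨ j = c) :
    ∃ g ∈ cubicBipartiteSpectralGaps n, ∀ f : Fin n × Bool → ℝ, ∑ p, f p = 0 →
      g * ∑ p, f p ^ 2 ≤ (bipartiteDouble (n := n) B hB).energy f := by
  classical
  let e : Fin (2 * n) ≃ Fin n × Bool := Fintype.equivOfCardEq (by simp [mul_comm])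
  obtain ⟨h1, h2, h4⟩ := SimpleGraph.comap_equiv_connected_regular_bipartite e
    (bipartiteDouble_connected (hB := hB) (by omega) h0 hs)
    (bipartiteDouble_isRegularOfDegree (hB := hB) h3) bipartiteDouble_isBipartite
  refine ⟨_, ⟨_, h1, ?_, h4, rfl⟩, fun f hf => ?_⟩
  · convert h2
  · have := (SimpleGraph.spectralGap_variational (by simp; omega) h1 h2).2 (f ∘ e)
      (by rw [← hf]; exact e.sum_comp f)
    rw [SimpleGraph.energy_comap] at this
    rw [← e.sum_comp]
    convert this
    rfl

theorem cubicBipartiteSpectralGaps_finite (n : ℕ) : (cubicBipartiteSpectralGaps n).Finite := by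
  classical
  refine (Set.finite_range fun G : SimpleGraph (Fin (2 * n)) => G.spectralGap).subset ?_
  rintro _ ⟨G, -, -, -, rfl⟩
  refine ⟨G, ?_⟩
  congr

theorem cubicBipartiteSpectralGaps_nonempty {n : ℕ} (hn : 3 ≤ n) :
    (cubicBipartiteSpectralGaps n).Nonempty := by
  -- The closed cycle works from `n = 3` on, where it is `K₃,₃`; the closed ladder rows are only
  -- available for `6 ≤ n`.
  obtain ⟨g, hg, -⟩ := bipartiteDouble_gap_mem hn (closedCycle_symm n)
    (by unfold closedCycle; omega) (fun i _ => by unfold closedCycle; omega) (closedCycle_rows hn)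
  exact ⟨g, hg⟩

/-- Every connected cubic bipartite graph on `2 * n` vertices has gap at least that of the path on
`n` vertices. -/
theorem le_of_mem_cubicBipartiteSpectralGaps {n : ℕ} (hn : 2 ≤ n) {g : ℝ}
    (hg : g ∈ cubicBipartiteSpectralGaps n) : 2 - 2 * Real.cos (Real.pi / n) ≤ g := by
  classical
  obtain ⟨G, hc, hr, hb, rfl⟩ := hg
  obtain ⟨f, h0, h1, h2⟩ := (SimpleGraph.spectralGap_variational (by simp; omega) hc hr).1
  have := SimpleGraph.energy_ge_of_sum_eq_zero hn hc hr hb f h0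
  rw [h1, mul_one, h2] at this
  exact this

theorem exists_mem_cubicBipartiteSpectralGaps_le {n : ℕ} (hn : 6 ≤ n) :
    ∃ g ∈ cubicBipartiteSpectralGaps n, g ≤ (Real.pi / n) ^ 2 + 36 * (Real.pi / n) ^ 4 := by
  obtain ⟨g, hg, hf⟩ := bipartiteDouble_gap_mem (by omega) (closedLadder_symm n)
    (by unfold closedLadder; omega) (fun i _ => by unfold closedLadder; omega)
    (closedLadder_rows hn)
  refine ⟨g, hg, ?_⟩
  have hz : ∑ p : Fin n × Bool, pathMode n p.1 = 0 := by
    have := sum_pathMode (n := n)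
    rw [← Fin.sum_univ_eq_sum_range] at this
    rw [Fintype.sum_prod_type_right]
    simp [this]
  have h1 := (hf (fun p => pathMode n p.1) hz).trans (closedLadder_energy_pathMode_le hn)
  refine le_of_mul_le_mul_right h1 ?_
  have h2 := half_le_sum_sq_pathMode (n := n) (by omega)
  rw [← Fin.sum_univ_eq_sum_range (fun k => pathMode n k ^ 2)] at h2
  rw [Fintype.sum_prod_type_right]
  simp only [Fintype.sum_bool]
  linarith

/-- For every `n ≥ 3` the minimum spectral gap of connected cubic bipartite graphs on `2 * n`
vertices exists, and it equals `(1 + o(1)) * π ^ 2 / n ^ 2`. -/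
theorem mainTheorem5 :
    ∃ ε : ℕ → ℝ, Filter.Tendsto ε Filter.atTop (nhds 0) ∧
      ∀ n : ℕ, 3 ≤ n →
        IsLeast (cubicBipartiteSpectralGaps n) ((1 + ε n) * (Real.pi ^ 2 / (n : ℝ) ^ 2)) := by
  set m : ℕ → ℝ := fun n => sInf (cubicBipartiteSpectralGaps n) with hm
  have hleast : ∀ n, 3 ≤ n → IsLeast (cubicBipartiteSpectralGaps n) (m n) := fun n hn =>
    ⟨(cubicBipartiteSpectralGaps_nonempty hn).csInf_mem (cubicBipartiteSpectralGaps_finite n),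
      fun _ hg => csInf_le (cubicBipartiteSpectralGaps_finite n).bddBelow hg⟩
  have hθ : Filter.Tendsto (fun n : ℕ => Real.pi / (n : ℝ)) Filter.atTop (nhds 0) :=
    tendsto_const_div_atTop_nhds_zero_nat Real.pi
  -- The relative error is squeezed between `-(π / n) ^ 2` and `36 * (π / n) ^ 2`.
  refine ⟨fun n => m n / (Real.pi / n) ^ 2 - 1, ?_, fun n hn => ?_⟩
  · have hlow : Filter.Tendsto (fun n : ℕ => -(Real.pi / (n : ℝ)) ^ 2) Filter.atTop (nhds 0) := by
      simpa using (hθ.pow 2).neg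
    have hup : Filter.Tendsto (fun n : ℕ => 36 * (Real.pi / (n : ℝ)) ^ 2) Filter.atTop
        (nhds 0) := by
      simpa using (hθ.pow 2).const_mul 36
    refine tendsto_of_tendsto_of_tendsto_of_le_of_le' hlow hup ?_ ?_ <;>
      filter_upwards [Filter.eventually_ge_atTop 6] with n hn
    · have hn6 : (6 : ℝ) ≤ n := by exact_mod_cast hn
      have hpos : 0 < Real.pi / n := div_pos Real.pi_pos (by linarith)
      have h1 : Real.pi / n ≤ 1 := by
        rw [div_le_one (by linarith)]
        linarith [Real.pi_le_four]
      have h2 := le_of_mem_cubicBipartiteSpectralGaps (by omega) (hleast n (by omega)).1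
      -- The quartic remainder of the cosine, valid since `π / n ≤ 1`, gives `2 - 2 * cos θ ≥ θ ^ 2
      -- - θ ^ 4`.
      have h3 := (abs_le.1 (Real.cos_bound (x := Real.pi / n) (by rwa [abs_of_pos hpos]))).2
      rw [abs_of_pos hpos] at h3
      set θ := Real.pi / n
      have h4 : 0 < θ ^ 4 := by positivity
      rw [le_sub_iff_add_le, le_div_iff₀ (by positivity)]
      nlinarith
    · have hn6 : (6 : ℝ) ≤ n := by exact_mod_cast hn
      have hpos : 0 < Real.pi / n := div_pos Real.pi_pos (by linarith)
      obtain ⟨g, hg, hle⟩ := exists_mem_cubicBipartiteSpectralGaps_le hn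
      have h2 := ((hleast n (by omega)).2 hg).trans hle
      rw [sub_le_iff_le_add, div_le_iff₀ (by positivity)]
      linarith
  · have hn0 : (n : ℝ) ≠ 0 := by exact_mod_cast (by omega : n ≠ 0)
    have hpi := Real.pi_ne_zero
    convert hleast n hn using 1
    field_simp
    ring
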